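/- Let $\Sigma$ be a finite alphabet with at least two symbols, and let $\Sigma^\omega$ and $\Sigma^*$ be the sets of infinite and of finite strings over $\Sigma$. A (Mealy-type) probabilistic finite automaton (PFA) over $\Sigma$ is a tuple $X=(R,W,\mu_R,\mu_W,\sigma)$, where $R$ (input states) and $W$ (output states) are non-empty, disjoint finite sets, $\mu_R: R\times\Sigma\times(R\cup W)\to[0,1]$ satisfies $\sum_{p}\mu_R(q,a,p)=1$ for all $q\in R$, $a\in\Sigma$; $\mu_W: W\times\Sigma\times(R\cup W)\to[0,1]$ satisfies $\sum_{a\in\Sigma}\sum_{p}\mu_W(q,a,p)=1$ for all $q\in W$; and $\sigma$ is a probability distribution on $R\cup W$. On an infinite input string $t\in\Sigma^\omega$ the automaton starts in a state drawn from $\sigma$; in an input state $q$ it reads the next symbol $a$ of $t$ and moves to $p$ with probability $\mu_R(q,a,p)$; in an output state $q$, with probability $\mu_W(q,a,p)$, it writes the symbol $a$ and moves to $p$. The random finite or infinite string that is written is denoted by $X(t)$. The PFA $X$ is star-like if $R=\{s\}$ is a singleton, $\mu_W(q,a,q')=0$ for all distinct $q,q'\in W$ and all $a\in\Sigma$, and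 $\sum_{a\in\Sigma}\mu_W(q,a,q)<1$ for all $q\in W$; it is in canonical form if $\sigma(s)=1$ and $\sigma(q)=0$ for all $q\in W$. For finite or infinite strings $u,v$ let $\operatorname{lcp}(u,v)\in\mathbb N\cup\{\infty\}$ be the length of their longest common prefix. For $n\in\mathbb N$ the smoothed trie height is $$H(\Sigma^\omega,n,X)=\sup_{A\subseteq\Sigma^\omega,\ |A|=n}\ \mathbb E\Bigl[\max_{s',t'\in A,\ s'\ne t'}\operatorname{lcp}\bigl(X(s'),X(t')\bigr)\Bigr]\in[0,\infty],$$ where the strings in $A$ are perturbed independently (and the maximum over an empty set of pairs is $0$). **Theorem.** Let $X=(\{s\},W,\mu_R,\mu_W,\sigma)$ be a star-like PFA over $\Sigma$ in canonical form such that $\mu_R(s,a,s)<1$ for all $a\in\Sigma$. Then the following two statements are equivalent: 1. for all $a,b\in\Sigma$: $\ \mu_R(s,a,s)+\sum_{q\in W}\mu_R(s,a,q)\,\bigl(\mu_W(q,b,q)+\mu_W(q,b,s)\bigr)<1$; 2. $H(\Sigma^\omega,n,X)\in O(\log n)$ as $n\to\infty$. Moreover, if (1) fails, then the height is unbounded: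 $H(\Sigma^\omega,n,X)=\infty$ for every $n\ge 2$. -/

import Mathlib

open MeasureTheory ProbabilityTheory
open scoped ENNReal

/-- A (Mealy-type) probabilistic finite automaton over the finite alphabet `A`, with set of input
states `R` and set of output states `W`.  `μR q a p` is the probability that, in input state `q` and
on reading the symbol `a`, the automaton moves to `p`; `μW q a p` is the probability that, in output
state `q`, the automaton writes the symbol `a` and moves to `p`; `σ` is the initial distribution. -/
structure PFA (A R W : Type*) [Fintype A] [Fintype R] [Fintype W] where
  nonempty_input : Nonempty R
  nonempty_output : Nonempty W
  μR : R → A → R ⊕ W → ℝ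
  μR_nonneg : ∀ q a p, 0 ≤ μR q a p
  μR_sum : ∀ q a, ∑ p, μR q a p = 1
  μW : W → A → R ⊕ W → ℝ
  μW_nonneg : ∀ q a p, 0 ≤ μW q a p
  μW_sum : ∀ q, ∑ a, ∑ p, μW q a p = 1
  σ : R ⊕ W → ℝ
  σ_nonneg : ∀ p, 0 ≤ σ p
  σ_sum : ∑ p, σ p = 1

/-- The probability mass function with the given real weights on a finite type. -/
noncomputable def pmfOfReal {ι : Type*} [Fintype ι] (f : ι → ℝ) (h0 : ∀ i, 0 ≤ f i)
    (h1 : ∑ i, f i = 1) : PMF ι :=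
  PMF.ofFintype (fun i => ENNReal.ofReal (f i)) (by
    rw [← ENNReal.ofReal_sum_of_nonneg (fun i _ => h0 i), h1, ENNReal.ofReal_one])

/-- A configuration of an automaton running on an infinite input string: the current state, the
number of input symbols that have been read, and the finite string that has been written. -/
@[ext] structure PFAConfig (A R W : Type*) where
  state : R ⊕ W
  read : ℕ
  out : List A

instance instMeasurableSpacePFAConfig (A R W : Type*) : MeasurableSpace (PFAConfig A R W) := ⊤

/-- Finite and infinite strings over `A` (`Stream'.Seq A`) carry the σ-algebra generated by the
individual symbols. -/
instance instMeasurableSpaceSeq (A : Type*) : MeasurableSpace (Stream'.Seq A) :=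
  ⨆ k : ℕ, MeasurableSpace.comap (fun u : Stream'.Seq A => u.get? k) ⊤

section output

variable {A R W : Type*}

open Classical in
/-- The `k`-th symbol (counted from `0`) of the output of a trajectory of configurations, if some
configuration has written more than `k` symbols. -/
noncomputable def outputSymbol (ω : ℕ → PFAConfig A R W) (k : ℕ) : Option A :=
  if h : ∃ n, k < (ω n).out.length then (ω (Nat.find h)).out[k]? else none

/-- The finite or infinite string written along a trajectory of configurations. -/
noncomputable def outputString (ω : ℕ → PFAConfig A R W) : Stream'.Seq A :=
  ⟨fun k => outputSymbol ω k, by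
    intro k hk
    by_contra hne
    have hk1 : ∃ n, k + 1 < (ω n).out.length := by
      by_contra hno
      exact hne (dif_neg hno)
    have hk0 : ∃ n, k < (ω n).out.length := hk1.imp fun n hn => by omega
    have hk' : outputSymbol ω k = none := hk
    classical
    rw [outputSymbol, dif_pos hk0, List.getElem?_eq_none_iff] at hk'
    have := Nat.find_spec hk0
    convert absurd hk' (not_le.mpr ?_)
    convert this⟩

lemma measurable_outputString :
    Measurable (outputString : (ℕ → PFAConfig A R W) → Stream'.Seq A) := by
  refine measurable_iff_comap_le.mpr ?_
  rw [show instMeasurableSpaceSeq A =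
    ⨆ k : ℕ, MeasurableSpace.comap (fun u : Stream'.Seq A => u.get? k) ⊤ from rfl,
    MeasurableSpace.comap_iSup]
  refine iSup_le fun k => ?_
  rw [MeasurableSpace.comap_comp]
  rintro _ ⟨B, -, rfl⟩
  have hm : ∀ (n : ℕ) (P : PFAConfig A R W → Prop),
      MeasurableSet {ω : ℕ → PFAConfig A R W | P (ω n)} := fun n P =>
    measurable_pi_apply (X := fun _ : ℕ => PFAConfig A R W) n
      (show MeasurableSet {c | P c} from trivial)
  have hset : ((fun u : Stream'.Seq A => u.get? k) ∘
        (outputString : (ℕ → PFAConfig A R W) → Stream'.Seq A)) ⁻¹' B =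
      (⋃ n : ℕ, ({ω | k < (ω n).out.length} ∩ (⋂ m : ℕ, ⋂ (_ : m < n),
        {ω | ¬ k < (ω m).out.length})) ∩ {ω | (ω n).out[k]? ∈ B}) ∪
      ((⋂ n : ℕ, {ω | ¬ k < (ω n).out.length}) ∩ {_ω | none ∈ B}) := by
    classical
    ext ω
    change outputSymbol ω k ∈ B ↔ _
    simp only [Set.mem_union, Set.mem_iUnion, Set.mem_inter_iff, Set.mem_iInter, Set.mem_ofPred_eq]
    by_cases h : ∃ n, k < (ω n).out.length
    · rw [outputSymbol, dif_pos h]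
      constructor
      · intro hB
        refine Or.inl ⟨Nat.find h, ⟨Nat.find_spec h, fun m hm => Nat.find_min h hm⟩, ?_⟩
        convert hB
      · rintro (⟨n, ⟨hn, hmin⟩, hB⟩ | ⟨hno, -⟩)
        · have : Nat.find h = n := (Nat.find_eq_iff h).mpr ⟨hn, hmin⟩
          rw [← this] at hB
          convert hB
        · exact absurd h (by push Not; intro n; exact not_lt.mp (hno n))
    · rw [outputSymbol, dif_neg h]
      push Not at h
      constructor
      · exact fun hB => Or.inr ⟨fun n => not_lt.mpr (h n), hB⟩
      · rintro (⟨n, ⟨hn, -⟩, -⟩ | ⟨-, hB⟩)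
        · exact absurd hn (not_lt.mpr (h n))
        · exact hB
  rw [hset]
  exact MeasurableSet.union
    (MeasurableSet.iUnion fun n => ((hm n fun c => k < c.out.length).inter
      (MeasurableSet.iInter fun m => MeasurableSet.iInter fun _ =>
        hm m fun c => ¬ k < c.out.length)).inter (hm n fun c => c.out[k]? ∈ B))
    ((MeasurableSet.iInter fun n => hm n fun c => ¬ k < c.out.length).inter
      (MeasurableSet.const _))

end output

namespace PFA

variable {A R W : Type*} [Fintype A] [Fintype R] [Fintype W]

/-- The distribution of the first configuration. -/
noncomputable def initial (X : PFA A R W) : PMF (PFAConfig A R W) :=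
  (pmfOfReal X.σ X.σ_nonneg X.σ_sum).map fun p => ⟨p, 0, []⟩

/-- One transition of the automaton on the infinite input string `t`: in an input state the next
symbol of `t` is read, in an output state a symbol is written. -/
noncomputable def step (X : PFA A R W) (t : ℕ → A) : PFAConfig A R W → PMF (PFAConfig A R W)
  | ⟨.inl q, i, out⟩ =>
      (pmfOfReal (X.μR q (t i)) (X.μR_nonneg q (t i)) (X.μR_sum q (t i))).map
        fun p => ⟨p, i + 1, out⟩
  | ⟨.inr q, i, out⟩ =>
      (pmfOfReal (fun ap : A × (R ⊕ W) => X.μW q ap.1 ap.2) (fun ap => X.μW_nonneg q ap.1 ap.2)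
        (by rw [Fintype.sum_prod_type]; exact X.μW_sum q)).map
        fun ap => ⟨ap.2, i, out ++ [ap.1]⟩

/-- The Markov kernel giving the next configuration from the history up to time `n`; it depends on
the current configuration only. -/
noncomputable def stepKernel (X : PFA A R W) (t : ℕ → A) (n : ℕ) :
    Kernel (Π _ : Finset.Iic n, PFAConfig A R W) (PFAConfig A R W) :=
  Kernel.comap ⟨fun c => (X.step t c).toMeasure, measurable_from_top⟩
    (fun h : (Π _ : Finset.Iic n, PFAConfig A R W) => h ⟨n, Finset.mem_Iic.mpr le_rfl⟩)
    (measurable_pi_apply _)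

instance instIsMarkovKernelStepKernel (X : PFA A R W) (t : ℕ → A) (n : ℕ) :
    IsMarkovKernel (X.stepKernel t n) :=
  ⟨fun h => PMF.toMeasure.isProbabilityMeasure
    (X.step t (h ⟨n, Finset.mem_Iic.mpr le_rfl⟩))⟩

/-- The law of the random trajectory of configurations of the automaton on the infinite input
string `t`. -/
noncomputable def trajectoryLaw (X : PFA A R W) (t : ℕ → A) :
    ProbabilityMeasure (ℕ → PFAConfig A R W) :=
  ⟨Kernel.trajMeasure (X := fun _ => PFAConfig A R W) X.initial.toMeasure (X.stepKernel t),
    inferInstance⟩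

/-- The string perturbation function represented by the automaton: the law of the finite or
infinite string that is written on the infinite input string `t`. -/
noncomputable def perturb (X : PFA A R W) (t : ℕ → A) : ProbabilityMeasure (Stream'.Seq A) :=
  (X.trajectoryLaw t).map measurable_outputString.aemeasurable

/-- Star-like automata: there is exactly one input state, there are no transitions between distinct
output states, and the automaton loops at each output state with probability less than one. -/
structure IsStarLike (X : PFA A R W) : Prop where
  card_input : Fintype.card R = 1
  no_cross : ∀ q q' : W, q ≠ q' → ∀ a, X.μW q a (.inr q') = 0
  loop_lt_one : ∀ q : W, ∑ a, X.μW q a (.inr q) < 1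

/-- Canonical form: the automaton starts in the input state `s` with probability one. -/
def IsCanonical (X : PFA A R W) (s : R) : Prop :=
  X.σ (.inl s) = 1 ∧ ∀ q : W, X.σ (.inr q) = 0

end PFA

/-- Length of the longest common prefix of two finite or infinite strings. -/
noncomputable def lcp {A : Type*} (u v : Stream'.Seq A) : ℕ∞ :=
  ⨆ (m : ℕ) (_ : ∀ i < m, ∃ a, u.get? i = some a ∧ v.get? i = some a), (m : ℕ∞)

/-- Height of the trie built over a family of strings: the largest length of a common prefix of two
members of the family with different indices. -/
noncomputable def trieHeight {A ι : Type*} (u : ι → Stream'.Seq A) : ℕ∞ :=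
  ⨆ (i : ι) (j : ι) (_ : i ≠ j), lcp (u i) (u j)

/-- The smoothed trie height `H(S, n, P)` for `n` distinct infinite input strings from `S` which are
perturbed independently, the string `t` being replaced by a random string with law `P t`. -/
noncomputable def smoothedTrieHeight {A : Type*} (S : Set (ℕ → A)) (n : ℕ)
    (P : (ℕ → A) → ProbabilityMeasure (Stream'.Seq A)) : ℝ≥0∞ :=
  ⨆ (T : Finset (ℕ → A)) (_ : (T : Set (ℕ → A)) ⊆ S) (_ : T.card = n),
    ∫⁻ u, (trieHeight u : ℝ≥0∞) ∂(ProbabilityMeasure.pi fun t : T => P t).toMeasure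

/-! Everything reduces to the probability that the output starts with a given word. If (1) holds,
this probability decays exponentially in the length of the word, uniformly in the input
(`exists_perturb_cylinderSet_le`). The function `wordBound` of the configuration is superharmonic,
equals 1 once the word `w` is completed and 0 after a mismatch, and starts at `ρ ^ |w|` in the input
state. A union bound over pairs and over words of length `m + 1` then gives P(height > m) ≤ n²
ρ^(m+1), and summing the tails beyond about 2 log n / log(1/ρ) gives O(log n)
(`exists_smoothedTrieHeight_le_log`). If (1) fails for `a`, `b`, the left side equals 1: reading `a`
either deletes it or leads to a state that surely writes `b` and then stays or returns. On a long
block of `a` only `b` is written, and since deletion is not certain, a geometrically decreasing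
weight and Markov's inequality show that `m` copies of `b` appear with probability at least 1/2
(`exists_half_le_perturb_replicate`). Distinct inputs may share an arbitrarily long block of `a`, so
the mean height is at least m / 2ⁿ for every `m` (`smoothedTrieHeight_eq_top`). This contradicts (2)
as well. -/

lemma lintegral_map_pmfOfReal {ι Ω : Type*} [Fintype ι] [MeasurableSpace Ω]
    [DiscreteMeasurableSpace Ω] (f : ι → ℝ) (h0 : ∀ i, 0 ≤ f i) (h1 : ∑ i, f i = 1) (g : ι → Ω)
    (F : Ω → ℝ≥0∞) :
    ∫⁻ c, F c ∂((pmfOfReal f h0 h1).map g).toMeasure = ∑ i, ENNReal.ofReal (f i) * F (g i) := by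
  let _ : MeasurableSpace ι := ⊤
  rw [← PMF.toMeasure_map (p := pmfOfReal f h0 h1) (f := g) (hf := measurable_from_top),
    lintegral_map (Measurable.of_discrete) measurable_from_top, lintegral_fintype]
  refine Finset.sum_congr rfl fun i _ => ?_
  rw [PMF.toMeasure_apply_singleton _ _ (MeasurableSet.of_discrete), mul_comm]
  rfl

instance instDiscreteMeasurableSpacePFAConfig (A R W : Type*) :
    DiscreteMeasurableSpace (PFAConfig A R W) := ⟨fun _ => trivial⟩

/-! ### One-step integrals and the Markov property of the trajectory law. -/

namespace PFA

variable {A R W : Type*} [Fintype A] [Fintype R] [Fintype W]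

lemma lintegral_step_inl (X : PFA A R W) (t : ℕ → A) (q : R) (i : ℕ) (o : List A)
    (F : PFAConfig A R W → ℝ≥0∞) :
    ∫⁻ c, F c ∂(X.step t ⟨.inl q, i, o⟩).toMeasure =
      ∑ p, ENNReal.ofReal (X.μR q (t i) p) * F ⟨p, i + 1, o⟩ :=
  lintegral_map_pmfOfReal _ (X.μR_nonneg q (t i)) (X.μR_sum q (t i)) _ F

lemma lintegral_step_inr (X : PFA A R W) (t : ℕ → A) (q : W) (i : ℕ) (o : List A)
    (F : PFAConfig A R W → ℝ≥0∞) :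
    ∫⁻ c, F c ∂(X.step t ⟨.inr q, i, o⟩).toMeasure =
      ∑ ap : A × (R ⊕ W), ENNReal.ofReal (X.μW q ap.1 ap.2) * F ⟨ap.2, i, o ++ [ap.1]⟩ :=
  lintegral_map_pmfOfReal (fun ap : A × (R ⊕ W) => X.μW q ap.1 ap.2) _ _ _ F

lemma lintegral_initial (X : PFA A R W) (F : PFAConfig A R W → ℝ≥0∞) :
    ∫⁻ c, F c ∂X.initial.toMeasure = ∑ p, ENNReal.ofReal (X.σ p) * F ⟨p, 0, []⟩ :=
  lintegral_map_pmfOfReal _ X.σ_nonneg X.σ_sum _ F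

lemma IsCanonical.lintegral_initial {X : PFA A R W} [Subsingleton R] {s : R}
    (h : X.IsCanonical s) (F : PFAConfig A R W → ℝ≥0∞) :
    ∫⁻ c, F c ∂X.initial.toMeasure = F ⟨.inl s, 0, []⟩ := by
  have : Unique R := ⟨⟨s⟩, fun x => Subsingleton.elim _ _⟩
  have hd : (default : R) = s := Subsingleton.elim _ _
  rw [PFA.lintegral_initial, Fintype.sum_sum_type, Fintype.sum_unique, hd, h.1]
  simp [h.2]

/-- This is the Markov property for a function of two consecutive configurations. Measurability is
assumed because a product of discrete σ-algebras need not be discrete. -/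
lemma lintegral_trajectoryLaw_succ (X : PFA A R W) (t : ℕ → A) (n : ℕ)
    (f : PFAConfig A R W → PFAConfig A R W → ℝ≥0∞)
    (hf : Measurable fun x : (Π _ : Finset.Iic n, PFAConfig A R W) × PFAConfig A R W =>
      f (x.1 ⟨n, Finset.mem_Iic.mpr le_rfl⟩) x.2) :
    ∫⁻ ω, f (ω n) (ω (n + 1)) ∂(X.trajectoryLaw t).toMeasure =
      ∫⁻ ω, ∫⁻ c, f (ω n) c ∂(X.step t (ω n)).toMeasure ∂(X.trajectoryLaw t).toMeasure := by
  have key := Kernel.map_frestrictLe_trajMeasure_compProd_eq_map_trajMeasure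
    (X := fun _ => PFAConfig A R W) (μ₀ := X.initial.toMeasure) (κ := X.stepKernel t) (a := n)
  have h1 : ∫⁻ ω, f (ω n) (ω (n + 1)) ∂(X.trajectoryLaw t).toMeasure =
      ∫⁻ x, f (x.1 ⟨n, Finset.mem_Iic.mpr le_rfl⟩) x.2
        ∂((Kernel.trajMeasure (X := fun _ => PFAConfig A R W) X.initial.toMeasure
          (X.stepKernel t)).map (fun x ↦ (Preorder.frestrictLe n x, x (n + 1)))) := by
    rw [lintegral_map hf (by fun_prop)]
    rfl
  rw [h1, ← key, Measure.lintegral_compProd hf, lintegral_map _ (by fun_prop)]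
  · rfl
  · exact Measurable.lintegral_kernel_prod_right' (κ := X.stepKernel t n) hf

lemma lintegral_trajectoryLaw_zero (X : PFA A R W) (t : ℕ → A) (f : PFAConfig A R W → ℝ≥0∞) :
    ∫⁻ ω, f (ω 0) ∂(X.trajectoryLaw t).toMeasure = ∫⁻ c, f c ∂X.initial.toMeasure := by
  have hm : ((X.trajectoryLaw t).toMeasure).map (fun ω => ω 0) = X.initial.toMeasure := by
    have h2 : ((X.trajectoryLaw t).toMeasure).map (Preorder.frestrictLe 0) =
        X.initial.toMeasure.map
          (MeasurableEquiv.piUnique (fun _ : Finset.Iic 0 => PFAConfig A R W)).symm := by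
      change (Kernel.trajMeasure (X := fun _ => PFAConfig A R W) _ _).map _ = _
      rw [Kernel.trajMeasure, Measure.map_comp _ _ (by fun_prop), Kernel.traj_map_frestrictLe,
        Kernel.partialTraj_self, Measure.id_comp]
    have h3 : (fun ω : ℕ → PFAConfig A R W => ω 0) =
        (fun x : (Π _ : Finset.Iic 0, PFAConfig A R W) => x ⟨0, by simp⟩) ∘
          Preorder.frestrictLe (π := fun _ => PFAConfig A R W) 0 := rfl
    rw [h3, ← Measure.map_map (by fun_prop) (by fun_prop), h2,
      Measure.map_map (by fun_prop) (by fun_prop)]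
    exact Measure.map_id
  rw [← hm, lintegral_map measurable_from_top (by fun_prop)]

/-- Drift inequality, iterated by the Markov property. It serves with `β = 1` for the
supermartingale `wordBound` and with `β < 1` for `constantWeight`. The drift is needed only before
time `N`, so only finitely many input symbols have to be controlled. -/
lemma lintegral_trajectoryLaw_le (X : PFA A R W) (t : ℕ → A) (β : ℝ≥0∞) (N : ℕ)
    (f : ℕ → PFAConfig A R W → ℝ≥0∞)
    (hf : ∀ n < N, ∀ c, ∫⁻ c', f (n + 1) c' ∂(X.step t c).toMeasure ≤ β * f n c) :
    ∫⁻ ω, f N (ω N) ∂(X.trajectoryLaw t).toMeasure ≤ β ^ N * ∫⁻ c, f 0 c ∂X.initial.toMeasure := by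
  have main : ∀ n ≤ N, ∫⁻ ω, f n (ω n) ∂(X.trajectoryLaw t).toMeasure ≤
      β ^ n * ∫⁻ c, f 0 c ∂X.initial.toMeasure := by
    intro n
    induction n with
    | zero => intro _; simp [lintegral_trajectoryLaw_zero]
    | succ n ih =>
      intro hn
      rw [X.lintegral_trajectoryLaw_succ t n (fun _ c => f (n + 1) c)
        (measurable_from_top.comp measurable_snd)]
      calc _ ≤ ∫⁻ ω, β * f n (ω n) ∂(X.trajectoryLaw t).toMeasure :=
            lintegral_mono fun ω => hf n (by omega) _
        _ = β * ∫⁻ ω, f n (ω n) ∂(X.trajectoryLaw t).toMeasure :=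
            lintegral_const_mul _ (measurable_from_top.comp (measurable_pi_apply n))
        _ ≤ β * (β ^ n * ∫⁻ c, f 0 c ∂X.initial.toMeasure) := by gcongr; exact ih (by omega)
        _ = _ := by rw [pow_succ]; ring
  exact main N le_rfl

/-- The sample space contains arbitrary sequences of configurations, so coherence of the written
words holds only almost surely: each step keeps the word or appends a symbol. -/
lemma ae_out_prefix (X : PFA A R W) (t : ℕ → A) :
    ∀ᵐ ω ∂(X.trajectoryLaw t).toMeasure, ∀ n, (ω n).out <+: (ω (n + 1)).out := by
  rw [ae_all_iff]
  intro n
  classical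
  let f : PFAConfig A R W → PFAConfig A R W → ℝ≥0∞ := fun c c' => if c.out <+: c'.out then 0 else 1
  -- Countability makes the product σ-algebra on pairs of configurations discrete.
  have : Countable (PFAConfig A R W) := by
    refine Function.Injective.countable
      (f := fun c : PFAConfig A R W => (c.state, c.read, c.out)) ?_
    rintro ⟨a, b, c⟩ ⟨a', b', c'⟩ h
    simpa using h
  have hff : Measurable (fun x : PFAConfig A R W × PFAConfig A R W => f x.1 x.2) :=
    Measurable.of_discrete
  have hf : Measurable fun x : (Π _ : Finset.Iic n, PFAConfig A R W) × PFAConfig A R W =>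
      f (x.1 ⟨n, Finset.mem_Iic.mpr le_rfl⟩) x.2 := by
    have hp : Measurable fun x : (Π _ : Finset.Iic n, PFAConfig A R W) × PFAConfig A R W =>
        (x.1 ⟨n, Finset.mem_Iic.mpr le_rfl⟩, x.2) := by fun_prop
    exact hff.comp hp
  have hf' : Measurable fun ω : ℕ → PFAConfig A R W => f (ω n) (ω (n + 1)) := by
    have hp : Measurable fun ω : ℕ → PFAConfig A R W => (ω n, ω (n + 1)) := by fun_prop
    exact hff.comp hp
  have h0 : ∫⁻ ω, f (ω n) (ω (n + 1)) ∂(X.trajectoryLaw t).toMeasure = 0 := by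
    rw [X.lintegral_trajectoryLaw_succ t n f hf]
    convert lintegral_zero with ω
    obtain ⟨q | q, i, o⟩ := ω n
    · rw [lintegral_step_inl]; simp [f]
    · rw [lintegral_step_inr]; simp [f]
  rw [lintegral_eq_zero_iff hf'] at h0
  filter_upwards [h0] with ω h
  by_contra hne
  simp [f, hne] at h

end PFA

/-! ### Cylinder events of the output string in terms of the written words. -/

lemma get?_outputString {A R W : Type*} {ω : ℕ → PFAConfig A R W}
    (h : ∀ n, (ω n).out <+: (ω (n + 1)).out) {n k : ℕ} (hk : k < (ω n).out.length) :
    (outputString ω).get? k = (ω n).out[k]? := by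
  classical
  have hmono : ∀ m n, m ≤ n → (ω m).out <+: (ω n).out := fun m n hmn => by
    induction n, hmn using Nat.le_induction with
    | base => exact List.prefix_rfl
    | succ n _ ih => exact ih.trans (h n)
  change outputSymbol ω k = _
  have hex : ∃ n, k < (ω n).out.length := ⟨n, hk⟩
  rw [outputSymbol, dif_pos hex]
  have hs : k < (ω (Nat.find hex)).out.length := Nat.find_spec hex
  have := (hmono _ _ (Nat.find_min' hex hk)).getElem hs
  rw [List.getElem?_eq_getElem hk, ← this, List.getElem?_eq_getElem]

lemma exists_lt_length_of_get?_outputString {A R W : Type*} {ω : ℕ → PFAConfig A R W} {k : ℕ}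
    {a : A} (h : (outputString ω).get? k = some a) : ∃ n, k < (ω n).out.length := by
  by_contra hno
  have h' : outputSymbol ω k = some a := h
  rw [outputSymbol, dif_neg hno] at h'
  simp at h'

/-- The finite or infinite strings that start with the word `w`. -/
def cylinderSet {A : Type*} (w : List A) : Set (Stream'.Seq A) :=
  {u | ∀ i < w.length, u.get? i = w[i]?}

lemma measurable_get? {A : Type*} (k : ℕ) :
    Measurable[instMeasurableSpaceSeq A, ⊤] (fun u : Stream'.Seq A => u.get? k) :=
  measurable_iff_comap_le.mpr (le_iSup (fun k : ℕ =>
    MeasurableSpace.comap (fun u : Stream'.Seq A => u.get? k) ⊤) k)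

lemma measurableSet_cylinderSet {A : Type*} (w : List A) : MeasurableSet (cylinderSet w) := by
  have : cylinderSet w = ⋂ i : ℕ, ⋂ _ : i < w.length,
      (fun u : Stream'.Seq A => u.get? i) ⁻¹' {w[i]?} := by
    ext u; simp [cylinderSet]
  rw [this]
  exact MeasurableSet.iInter fun i => MeasurableSet.iInter fun _ => measurable_get? i trivial

lemma outputString_mem_cylinderSet_iff {A R W : Type*} {ω : ℕ → PFAConfig A R W}
    (h : ∀ n, (ω n).out <+: (ω (n + 1)).out) (w : List A) :
    outputString ω ∈ cylinderSet w ↔ ∃ n, w <+: (ω n).out := by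
  constructor
  · intro hu
    rcases Nat.eq_zero_or_pos w.length with h0 | hpos
    · exact ⟨0, by simp [List.length_eq_zero_iff.mp h0]⟩
    -- A configuration that has written the last symbol of `w` has written all of `w`.
    · have hl := hu (w.length - 1) (by omega)
      rw [List.getElem?_eq_getElem (by omega)] at hl
      obtain ⟨n, hn⟩ := exists_lt_length_of_get?_outputString hl
      refine ⟨n, List.prefix_iff_getElem?.mpr fun i hi => ?_⟩
      rw [← get?_outputString h (by omega : i < _), hu i hi, List.getElem?_eq_getElem hi]
  · rintro ⟨n, hn⟩ i hi
    rw [get?_outputString h (hi.trans_le hn.length_le), List.prefix_iff_getElem?.mp hn i hi,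
      List.getElem?_eq_getElem hi]

namespace PFA

variable {A R W : Type*} [Fintype A] [Fintype R] [Fintype W]

lemma perturb_cylinderSet (X : PFA A R W) (t : ℕ → A) (w : List A) :
    (X.perturb t).toMeasure (cylinderSet w) =
      (X.trajectoryLaw t).toMeasure {ω | ∃ n, w <+: (ω n).out} := by
  rw [perturb, ProbabilityMeasure.toMeasure_map,
    Measure.map_apply measurable_outputString (measurableSet_cylinderSet w)]
  refine measure_congr ?_
  filter_upwards [X.ae_out_prefix t] with ω h
  exact propext (outputString_mem_cylinderSet_iff h w)

lemma perturb_cylinderSet_eq_iSup (X : PFA A R W) (t : ℕ → A) (w : List A) :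
    (X.perturb t).toMeasure (cylinderSet w) =
      ⨆ n, (X.trajectoryLaw t).toMeasure {ω | w <+: (ω n).out} := by
  have hae : ∀ᵐ ω ∂(X.trajectoryLaw t).toMeasure, ∀ m n, m ≤ n → (ω m).out <+: (ω n).out := by
    filter_upwards [X.ae_out_prefix t] with ω h m n hmn
    induction n, hmn using Nat.le_induction with
    | base => exact List.prefix_rfl
    | succ n _ ih => exact ih.trans (h n)
  -- The events at time `n` increase only almost surely; allowing any time `m ≤ n` makes them
  -- increase everywhere, as continuity from below requires.
  have hS : {ω : ℕ → PFAConfig A R W | ∃ n, w <+: (ω n).out} =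
      ⋃ n, {ω | ∃ m ≤ n, w <+: (ω m).out} := by
    ext ω
    simp only [Set.mem_iUnion]
    exact ⟨fun ⟨n, hn⟩ => ⟨n, n, le_rfl, hn⟩, fun ⟨n, m, _, hn⟩ => ⟨m, hn⟩⟩
  rw [perturb_cylinderSet, hS, Monotone.measure_iUnion]
  · refine iSup_congr fun n => measure_congr ?_
    filter_upwards [hae] with ω h
    exact propext ⟨fun ⟨m, hm, hw⟩ => hw.trans (h m n hm), fun hw => ⟨n, le_rfl, hw⟩⟩
  · rintro n n' hn ω ⟨m, hm, hw⟩
    exact ⟨m, hm.trans hn, hw⟩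

end PFA

/-! ### Exponential decay of cylinder probabilities under condition (1). -/

namespace PFA

variable {A R W : Type*} [Fintype A] [Fintype R] [Fintype W]

/-- The rates `K` and `ρ` of the exponential supermartingale controlling the written word. -/
lemma exists_contraction_rates (X : PFA A R W) (s : R) (hstar : X.IsStarLike)
    (h : ∀ a b : A, X.μR s a (.inl s) +
        ∑ q : W, X.μR s a (.inr q) * (X.μW q b (.inr q) + X.μW q b (.inl s)) < 1) :
    ∃ K ρ : ℝ, 1 ≤ K ∧ 0 < ρ ∧ ρ < 1 ∧
      (∀ a b, X.μR s a (.inl s) * ρ +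
        K * ∑ q : W, X.μR s a (.inr q) * (X.μW q b (.inr q) + X.μW q b (.inl s)) ≤ ρ) ∧
      ∀ q b, X.μW q b (.inr q) * K + X.μW q b (.inl s) ≤ K * ρ := by
  have hpair : ∀ q b, X.μW q b (.inr q) + X.μW q b (.inl s) ≤ 1 := by
    classical
    intro q b
    calc _ = ∑ p ∈ ({.inr q, .inl s} : Finset (R ⊕ W)), X.μW q b p := by
          rw [Finset.sum_pair (by simp)]
      _ ≤ ∑ p, X.μW q b p := Finset.sum_le_univ_sum_of_nonneg (X.μW_nonneg q b)
      _ ≤ ∑ a, ∑ p, X.μW q a p := Finset.single_le_sum (f := fun a => ∑ p, X.μW q a p)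
          (fun a _ => Finset.sum_nonneg fun p _ => X.μW_nonneg q a p) (Finset.mem_univ b)
      _ = 1 := X.μW_sum q
  have hloop : ∀ q b, X.μW q b (.inr q) < 1 := fun q b =>
    (Finset.single_le_sum (f := fun a => X.μW q a (.inr q))
      (fun a _ => X.μW_nonneg q a _) (Finset.mem_univ b)).trans_lt (hstar.loop_lt_one q)
  -- `K` is chosen before `ρ`: close enough to 1 to keep the finitely many inequalities (1) strict,
  -- but above 1 because an output state may write a symbol surely.
  have hK : ∀ᶠ K : ℝ in nhdsWithin 1 (Set.Ioi 1), 1 < K ∧ ∀ a b, X.μR s a (.inl s) +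
      K * ∑ q : W, X.μR s a (.inr q) * (X.μW q b (.inr q) + X.μW q b (.inl s)) < 1 := by
    refine (eventually_mem_nhdsWithin).and (Filter.Eventually.filter_mono nhdsWithin_le_nhds ?_)
    simp only [Filter.eventually_all]
    intro a b
    refine ContinuousAt.eventually_lt (by fun_prop) continuousAt_const ?_
    simpa using h a b
  obtain ⟨K, hK1, hK⟩ := hK.exists
  have hρ : ∀ᶠ ρ : ℝ in nhdsWithin 1 (Set.Iio 1), ρ < 1 ∧ 0 < ρ ∧
      (∀ a b, X.μR s a (.inl s) * ρ +
        K * ∑ q : W, X.μR s a (.inr q) * (X.μW q b (.inr q) + X.μW q b (.inl s)) < ρ) ∧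
      ∀ q b, X.μW q b (.inr q) * K + X.μW q b (.inl s) < K * ρ := by
    refine (eventually_mem_nhdsWithin).and (Filter.Eventually.filter_mono nhdsWithin_le_nhds ?_)
    simp only [Filter.eventually_and, Filter.eventually_all]
    refine ⟨lt_mem_nhds one_pos, fun a b => ?_, fun q b => ?_⟩
    · refine ContinuousAt.eventually_lt (by fun_prop) (by fun_prop) ?_
      simpa using hK a b
    · refine ContinuousAt.eventually_lt (by fun_prop) (by fun_prop) ?_
      -- With `x` the loop probability on `b`, the left side at `ρ = 1` is at most `x * K + (1 - x)
      -- = K - (K - 1) * (1 - x)`, which is below `K` because `x < 1 < K`.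
      nlinarith [hpair q b, hloop q b]
  obtain ⟨ρ, hρ1, hρ0, hs, hq⟩ := hρ.exists
  exact ⟨K, ρ, hK1.le, hρ0, hρ1, fun a b => (hs a b).le, fun q b => (hq q b).le⟩

/-- An upper bound for the probability that, from the state `p`, a star-like automaton completes the
word `w` of which `o` has been written. -/
noncomputable def wordBound (X : PFA A R W) (s : R) (K ρ : ℝ) (p : R ⊕ W) :
    List A → List A → ℝ
  | [], _ => 1
  | b :: w, [] => p.elim (fun _ => ρ ^ (w.length + 1))
      (fun q => ρ ^ w.length * (X.μW q b (.inr q) * K + X.μW q b (.inl s)))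
  | b :: w, b' :: o => open Classical in if b = b' then wordBound X s K ρ p w o else 0

section

variable {X : PFA A R W} {s : R} {K ρ : ℝ}

lemma wordBound_nonneg (hK : 0 ≤ K) (hρ : 0 ≤ ρ) (p : R ⊕ W) (w o : List A) :
    0 ≤ X.wordBound s K ρ p w o := by
  fun_induction wordBound X s K ρ p w o with
  | case1 => exact zero_le_one
  | case2 b w =>
    rcases p with r | q
    · exact pow_nonneg hρ _
    · exact mul_nonneg (pow_nonneg hρ _)
        (add_nonneg (mul_nonneg (X.μW_nonneg _ _ _) hK) (X.μW_nonneg _ _ _))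
  | case3 b w o ih => exact ih
  | case4 => exact le_rfl

lemma wordBound_of_prefix (p : R ⊕ W) {w o : List A} (h : w <+: o) :
    X.wordBound s K ρ p w o = 1 := by
  induction w generalizing o with
  | nil => simp [wordBound]
  | cons b w ih =>
    obtain ⟨o', rfl⟩ := h
    simp [wordBound, ih]

lemma wordBound_inl_nil (r : R) (w : List A) :
    X.wordBound s K ρ (.inl r) w [] = ρ ^ w.length := by
  cases w <;> simp [wordBound]

lemma wordBound_inr_nil_le (hK : 1 ≤ K) (hρ : 0 ≤ ρ)
    (hq : ∀ q b, X.μW q b (.inr q) * K + X.μW q b (.inl s) ≤ K * ρ) (q : W) (w : List A) :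
    X.wordBound s K ρ (.inr q) w [] ≤ K * ρ ^ w.length := by
  cases w with
  | nil => simpa [wordBound] using hK
  | cons b w =>
    simp only [wordBound, Sum.elim_inr, List.length_cons]
    calc _ ≤ ρ ^ w.length * (K * ρ) := by gcongr; exact hq q b
      _ = _ := by ring

/-- Superharmonicity at the input state. Matched symbols are stripped by induction; what remains is
`hs` scaled by a power of `ρ`. -/
lemma sum_μR_mul_wordBound_le [Subsingleton R] (hρ : 0 ≤ ρ) (hK : 1 ≤ K)
    (hs : ∀ a b, X.μR s a (.inl s) * ρ +
        K * ∑ q : W, X.μR s a (.inr q) * (X.μW q b (.inr q) + X.μW q b (.inl s)) ≤ ρ)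
    (a : A) (w o : List A) :
    ∑ p, X.μR s a p * X.wordBound s K ρ p w o ≤ X.wordBound s K ρ (.inl s) w o := by
  induction w generalizing o with
  | nil => simp [wordBound, X.μR_sum]
  | cons b w ih =>
    cases o with
    | nil =>
      let _ : Unique R := ⟨⟨s⟩, fun x => Subsingleton.elim _ _⟩
      have hd : (default : R) = s := Subsingleton.elim _ _
      rw [Fintype.sum_sum_type, Fintype.sum_unique, hd]
      simp only [wordBound, Sum.elim_inl, Sum.elim_inr]
      have h1 : ∑ q : W, X.μR s a (.inr q) * (ρ ^ w.length *
          (X.μW q b (.inr q) * K + X.μW q b (.inl s))) ≤ ρ ^ w.length * (K * ∑ q : W,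
            X.μR s a (.inr q) * (X.μW q b (.inr q) + X.μW q b (.inl s))) := by
        rw [Finset.mul_sum, Finset.mul_sum]
        refine Finset.sum_le_sum fun q _ => ?_
        have h2 : X.μW q b (.inr q) * K + X.μW q b (.inl s) ≤
            K * (X.μW q b (.inr q) + X.μW q b (.inl s)) := by
          nlinarith [X.μW_nonneg q b (.inl s)]
        calc _ = (X.μR s a (.inr q) * ρ ^ w.length) *
              (X.μW q b (.inr q) * K + X.μW q b (.inl s)) := by ring
          _ ≤ (X.μR s a (.inr q) * ρ ^ w.length) *
              (K * (X.μW q b (.inr q) + X.μW q b (.inl s))) :=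
            mul_le_mul_of_nonneg_left h2 (mul_nonneg (X.μR_nonneg _ _ _) (pow_nonneg hρ _))
          _ = _ := by ring
      have h3 := mul_le_mul_of_nonneg_left (hs a b) (pow_nonneg hρ w.length)
      rw [pow_succ]
      linarith
    | cons b' o =>
      by_cases hb : b = b'
      · simpa [wordBound, hb] using ih o
      · simp [wordBound, hb]

/-- Superharmonicity at an output state. When the next required symbol is `b`, only writing `b`
avoids a mismatch, and star-likeness leaves two successors: `q`, where the bound is at most `K * ρ ^
w.length`, and the input state, where it is `ρ ^ w.length`. The value of `wordBound` at `q` is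
defined as the resulting mean. -/
lemma sum_μW_mul_wordBound_le [Subsingleton R] (hstar : X.IsStarLike) (hρ : 0 ≤ ρ) (hK : 1 ≤ K)
    (hq : ∀ q b, X.μW q b (.inr q) * K + X.μW q b (.inl s) ≤ K * ρ) (q : W) (w o : List A) :
    ∑ ap : A × (R ⊕ W), X.μW q ap.1 ap.2 * X.wordBound s K ρ ap.2 w (o ++ [ap.1]) ≤
      X.wordBound s K ρ (.inr q) w o := by
  classical
  induction w generalizing o with
  | nil =>
    have := X.μW_sum q
    rw [← Fintype.sum_prod_type'] at this
    simp [wordBound, this]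
  | cons b w ih =>
    cases o with
    | nil =>
      let _ : Unique R := ⟨⟨s⟩, fun x => Subsingleton.elim _ _⟩
      have hd : (default : R) = s := Subsingleton.elim _ _
      rw [Fintype.sum_prod_type, Finset.sum_eq_single b]
      · rw [Fintype.sum_sum_type, Fintype.sum_unique, hd, Finset.sum_eq_single q]
        · simp only [wordBound, List.nil_append, if_true, Sum.elim_inr, wordBound_inl_nil]
          have := mul_le_mul_of_nonneg_left (wordBound_inr_nil_le (X := X) hK hρ hq q w)
            (X.μW_nonneg q b (.inr q))
          linarith
        · intro q' _ hne
          rw [hstar.no_cross q q' hne.symm, zero_mul]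
        · simp
      · intro b' _ hne
        simp [wordBound, hne.symm]
      · simp
    | cons b' o =>
      by_cases hb : b = b'
      · simpa [wordBound, hb] using ih o
      · simp [wordBound, hb]

end

lemma exists_perturb_cylinderSet_le (X : PFA A R W) (s : R) (hstar : X.IsStarLike)
    (hcan : X.IsCanonical s)
    (h : ∀ a b : A, X.μR s a (.inl s) +
        ∑ q : W, X.μR s a (.inr q) * (X.μW q b (.inr q) + X.μW q b (.inl s)) < 1) :
    ∃ ρ : ℝ, 0 < ρ ∧ ρ < 1 ∧ ∀ t w,
      (X.perturb t).toMeasure (cylinderSet w) ≤ ENNReal.ofReal ρ ^ w.length := by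
  obtain ⟨K, ρ, hK, hρ, hρ1, hs, hq⟩ := X.exists_contraction_rates s hstar h
  have hR : Subsingleton R := Fintype.card_le_one_iff_subsingleton.mp hstar.card_input.le
  refine ⟨ρ, hρ, hρ1, fun t w => ?_⟩
  have hnn := wordBound_nonneg (X := X) (s := s) (zero_le_one.trans hK) hρ.le
  rw [perturb_cylinderSet_eq_iSup]
  refine iSup_le fun n => ?_
  let F : PFAConfig A R W → ℝ≥0∞ := fun c => ENNReal.ofReal (X.wordBound s K ρ c.state w c.out)
  have hF := X.lintegral_trajectoryLaw_le t 1 n (fun _ => F) (by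
    rintro - - ⟨r | q, i, o⟩
    · obtain rfl : r = s := Subsingleton.elim _ _
      rw [lintegral_step_inl, one_mul]
      simp only [F]
      simp_rw [← ENNReal.ofReal_mul (X.μR_nonneg _ _ _)]
      rw [← ENNReal.ofReal_sum_of_nonneg fun p _ => mul_nonneg (X.μR_nonneg _ _ _) (hnn _ _ _)]
      exact ENNReal.ofReal_le_ofReal (sum_μR_mul_wordBound_le hρ.le hK hs _ _ _)
    · rw [lintegral_step_inr, one_mul]
      simp only [F]
      simp_rw [← ENNReal.ofReal_mul (X.μW_nonneg _ _ _)]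
      rw [← ENNReal.ofReal_sum_of_nonneg fun p _ => mul_nonneg (X.μW_nonneg _ _ _) (hnn _ _ _)]
      exact ENNReal.ofReal_le_ofReal (sum_μW_mul_wordBound_le hstar hρ.le hK hq _ _ _))
  rw [hcan.lintegral_initial, one_pow, one_mul] at hF
  simp only [F, wordBound_inl_nil, ENNReal.ofReal_pow hρ.le] at hF
  refine le_trans ?_ hF
  have hm : MeasurableSet {ω : ℕ → PFAConfig A R W | w <+: (ω n).out} :=
    measurable_pi_apply (X := fun _ : ℕ => PFAConfig A R W) n
      (show MeasurableSet {c : PFAConfig A R W | w <+: c.out} from trivial)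
  rw [← lintegral_indicator_one hm]
  refine lintegral_mono fun ω => ?_
  by_cases hw : w <+: (ω n).out
  · simp [Set.indicator, hw, wordBound_of_prefix _ hw]
  · simp [Set.indicator, hw]

end PFA

/-! ### From cylinder bounds to the expected trie height. -/

section height

variable {A : Type*}

lemma lt_lcp_iff (u v : Stream'.Seq A) (m : ℕ) :
    (m : ℕ∞) < lcp u v ↔
      ∃ w : Fin (m + 1) → A, u ∈ cylinderSet (List.ofFn w) ∧ v ∈ cylinderSet (List.ofFn w) := by
  simp only [lcp, lt_iSup_iff, Nat.cast_lt, exists_prop]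
  constructor
  · rintro ⟨k, hk, hmk⟩
    choose a hu hv using fun i : Fin (m + 1) => hk i (by omega)
    refine ⟨a, fun i hi => ?_, fun i hi => ?_⟩ <;> rw [List.length_ofFn] at hi
    · simpa [hi, -List.ofFn_succ] using hu ⟨i, hi⟩
    · simpa [hi, -List.ofFn_succ] using hv ⟨i, hi⟩
  · rintro ⟨w, hu, hv⟩
    refine ⟨m + 1, fun i hi => ⟨w ⟨i, hi⟩, ?_, ?_⟩, by omega⟩
    · rw [hu i (by simpa using hi)]; simp [hi, -List.ofFn_succ]
    · rw [hv i (by simpa using hi)]; simp [hi, -List.ofFn_succ]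

lemma setOf_lt_trieHeight_eq {ι : Type*} (m : ℕ) :
    {u : ι → Stream'.Seq A | (m : ℕ∞) < trieHeight u} =
      ⋃ (i : ι) (j : ι) (_ : i ≠ j) (w : Fin (m + 1) → A),
        {u | u i ∈ cylinderSet (List.ofFn w)} ∩ {u | u j ∈ cylinderSet (List.ofFn w)} := by
  ext u
  simp [trieHeight, lt_iSup_iff, lt_lcp_iff]

lemma measurableSet_lt_trieHeight [Finite A] {ι : Type*} [Finite ι] (m : ℕ) :
    MeasurableSet {u : ι → Stream'.Seq A | (m : ℕ∞) < trieHeight u} := by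
  rw [setOf_lt_trieHeight_eq]
  have hm : ∀ (i : ι) (w : List A),
      MeasurableSet {u : ι → Stream'.Seq A | u i ∈ cylinderSet w} := fun i w =>
    measurable_pi_apply (X := fun _ : ι => Stream'.Seq A) i (measurableSet_cylinderSet w)
  exact MeasurableSet.iUnion fun i => MeasurableSet.iUnion fun j => MeasurableSet.iUnion fun _ =>
    MeasurableSet.iUnion fun w => (hm i _).inter (hm j _)

lemma toENNReal_eq_tsum_indicator (x : ℕ∞) :
    (x : ℝ≥0∞) = ∑' m : ℕ, if (m : ℕ∞) < x then (1 : ℝ≥0∞) else 0 := by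
  induction x using ENat.recTopCoe with
  | top => simp
  | coe n =>
    rw [tsum_eq_sum (s := Finset.range n)]
    · rw [Finset.sum_congr rfl (g := fun _ => (1 : ℝ≥0∞))]
      · simp
      · intro m hm
        simpa using hm
    · intro m hm
      simpa using hm

lemma sum_cylinderSet_ofFn_le_one [Fintype A] (μ : ProbabilityMeasure (Stream'.Seq A)) (k : ℕ) :
    ∑ w : Fin k → A, μ.toMeasure (cylinderSet (List.ofFn w)) ≤ 1 := by
  have hd : Pairwise (Function.onFun Disjoint
      fun w : Fin k → A => cylinderSet (List.ofFn w)) := by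
    intro w w' hne
    refine Set.disjoint_left.mpr fun u hu hu' => hne ?_
    refine funext fun i => ?_
    have h1 := hu i (by simp)
    have h2 := hu' i (by simp)
    rw [h1] at h2
    simpa using h2
  rw [← tsum_fintype (L := .unconditional _),
    ← measure_iUnion hd fun w => measurableSet_cylinderSet _]
  exact prob_le_one

variable [Fintype A] {ι : Type*} [Fintype ι]

/-- For a fixed pair, independence gives a sum over words of products of two cylinder probabilities.
One factor is bounded by `r ^ (m + 1)`; the other sums to at most 1, since cylinders of equal length
are disjoint, so the number of words does not enter. -/
lemma pi_lt_trieHeight_le (μ : ι → ProbabilityMeasure (Stream'.Seq A)) (r : ℝ≥0∞)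
    (h : ∀ i w, (μ i).toMeasure (cylinderSet w) ≤ r ^ w.length) (m : ℕ) :
    (ProbabilityMeasure.pi μ).toMeasure {u | (m : ℕ∞) < trieHeight u} ≤
      (Fintype.card ι : ℝ≥0∞) ^ 2 * r ^ (m + 1) := by
  have hpair : ∀ i j : ι, i ≠ j → (ProbabilityMeasure.pi μ).toMeasure
      (⋃ w : Fin (m + 1) → A, {u | u i ∈ cylinderSet (List.ofFn w)} ∩
        {u | u j ∈ cylinderSet (List.ofFn w)}) ≤ r ^ (m + 1) := by
    intro i j hij
    have hind : IndepFun (fun u : ι → Stream'.Seq A => u i) (fun u => u j)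
        (Measure.pi fun i => (μ i).toMeasure) :=
      (iIndepFun_pi (X := fun _ u => u) (μ := fun i => (μ i).toMeasure)
        fun i => aemeasurable_id).indepFun hij
    have heval : ∀ (i : ι) (w : List A), (Measure.pi fun i => (μ i).toMeasure)
        ((fun u : ι → Stream'.Seq A => u i) ⁻¹' cylinderSet w) =
          (μ i).toMeasure (cylinderSet w) := fun i w =>
      (measurePreserving_eval (fun i => (μ i).toMeasure) i).measure_preimage
        (measurableSet_cylinderSet w).nullMeasurableSet
    rw [ProbabilityMeasure.toMeasure_pi]
    calc _ ≤ ∑ w : Fin (m + 1) → A, (Measure.pi fun i => (μ i).toMeasure)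
            ({u | u i ∈ cylinderSet (List.ofFn w)} ∩ {u | u j ∈ cylinderSet (List.ofFn w)}) :=
          measure_iUnion_fintype_le _ _
      _ = ∑ w : Fin (m + 1) → A, (μ i).toMeasure (cylinderSet (List.ofFn w)) *
            (μ j).toMeasure (cylinderSet (List.ofFn w)) := by
          refine Finset.sum_congr rfl fun w _ => ?_
          rw [← heval i, ← heval j]
          exact hind.measure_inter_preimage_eq_mul _ _ (measurableSet_cylinderSet _)
            (measurableSet_cylinderSet _)
      _ ≤ ∑ w : Fin (m + 1) → A, (μ i).toMeasure (cylinderSet (List.ofFn w)) * r ^ (m + 1) := by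
          gcongr with w
          simpa using h j (List.ofFn w)
      _ = (∑ w : Fin (m + 1) → A, (μ i).toMeasure (cylinderSet (List.ofFn w))) * r ^ (m + 1) := by
          rw [Finset.sum_mul]
      _ ≤ 1 * r ^ (m + 1) := by gcongr; exact sum_cylinderSet_ofFn_le_one _ _
      _ = _ := one_mul _
  rw [setOf_lt_trieHeight_eq]
  calc _ ≤ ∑ _i : ι, ∑ _j : ι, r ^ (m + 1) := by
        refine (measure_iUnion_fintype_le _ _).trans (Finset.sum_le_sum fun i _ => ?_)
        refine (measure_iUnion_fintype_le _ _).trans (Finset.sum_le_sum fun j _ => ?_)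
        by_cases hij : i = j
        · simp [hij]
        · simpa [hij] using hpair i j hij
    _ = _ := by simp; ring

lemma lintegral_trieHeight_eq_tsum (μ : Measure (ι → Stream'.Seq A)) :
    ∫⁻ u, (trieHeight u : ℝ≥0∞) ∂μ = ∑' m : ℕ, μ {u | (m : ℕ∞) < trieHeight u} := by
  simp_rw [toENNReal_eq_tsum_indicator]
  rw [lintegral_tsum]
  · refine tsum_congr fun m => ?_
    rw [← lintegral_indicator_one (measurableSet_lt_trieHeight m)]
    refine lintegral_congr fun u => ?_
    simp [Set.indicator]
  · exact fun m => (Measurable.ite (measurableSet_lt_trieHeight m) measurable_const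
      measurable_const).aemeasurable

lemma lintegral_trieHeight_le (μ : ι → ProbabilityMeasure (Stream'.Seq A)) (r : ℝ≥0∞)
    (h : ∀ i w, (μ i).toMeasure (cylinderSet w) ≤ r ^ w.length) (M : ℕ)
    (hM : (Fintype.card ι : ℝ≥0∞) ^ 2 * r ^ M ≤ 1) :
    ∫⁻ u, (trieHeight u : ℝ≥0∞) ∂(ProbabilityMeasure.pi μ).toMeasure ≤ M + (1 - r)⁻¹ * r := by
  -- Below `M` the tail probabilities are bounded by 1; from `M` on, `hM` absorbs the number of
  -- pairs and a geometric series remains.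
  rw [lintegral_trieHeight_eq_tsum, ← ENNReal.summable.sum_add_tsum_nat_add' (k := M)]
  gcongr ?_ + ?_
  · calc _ ≤ ∑ _m ∈ Finset.range M, (1 : ℝ≥0∞) := Finset.sum_le_sum fun _ _ => prob_le_one
      _ = M := by simp
  · calc _ ≤ ∑' m : ℕ, r ^ m * r := ENNReal.tsum_le_tsum fun m => by
          refine (pi_lt_trieHeight_le μ r h _).trans ?_
          calc _ = ((Fintype.card ι : ℝ≥0∞) ^ 2 * r ^ M) * (r ^ m * r) := by ring
            _ ≤ 1 * (r ^ m * r) := by gcongr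
            _ = _ := one_mul _
      _ = _ := by rw [ENNReal.tsum_mul_right, ENNReal.tsum_geometric]

end height

lemma exists_smoothedTrieHeight_le_log {A : Type*} [Fintype A]
    (P : (ℕ → A) → ProbabilityMeasure (Stream'.Seq A)) {ρ : ℝ} (hρ : 0 < ρ) (hρ1 : ρ < 1)
    (h : ∀ t w, (P t).toMeasure (cylinderSet w) ≤ ENNReal.ofReal ρ ^ w.length) :
    ∃ C : ℝ, ∀ᶠ n : ℕ in Filter.atTop,
      smoothedTrieHeight Set.univ n P ≤ ENNReal.ofReal (C * Real.log n) := by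
  have hL : 0 < -Real.log ρ := neg_pos.mpr (Real.log_neg hρ hρ1)
  have h1ρ : 0 < 1 - ρ := sub_pos.mpr hρ1
  -- The second summand absorbs the rounding error of `M` and the geometric series, using `log n ≥
  -- log 2`.
  refine ⟨2 / -Real.log ρ + (1 + (1 - ρ)⁻¹ * ρ) / Real.log 2, ?_⟩
  filter_upwards [Filter.eventually_ge_atTop 2] with n hn
  have hn0 : (0 : ℝ) < n := by positivity
  have hlog2 : 0 < Real.log 2 := Real.log_pos one_lt_two
  have hlog : Real.log 2 ≤ Real.log n := Real.log_le_log two_pos (by exact_mod_cast hn)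
  refine iSup_le fun T => iSup_le fun _ => iSup_le fun hT => ?_
  set M := ⌈2 * Real.log n / -Real.log ρ⌉₊ with hMdef
  have hM : (n : ℝ) ^ 2 * ρ ^ M ≤ 1 := by
    have h1 : 2 * Real.log n ≤ M * -Real.log ρ := (div_le_iff₀ hL).mp (Nat.le_ceil _)
    rw [← Real.log_nonpos_iff (by positivity), Real.log_mul (by positivity) (by positivity),
      Real.log_pow, Real.log_pow]
    push_cast
    linarith
  have hM' : (Fintype.card T : ℝ≥0∞) ^ 2 * ENNReal.ofReal ρ ^ M ≤ 1 := by
    rw [Fintype.card_coe, hT, ← ENNReal.ofReal_natCast, ← ENNReal.ofReal_pow hn0.le,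
      ← ENNReal.ofReal_pow hρ.le, ← ENNReal.ofReal_mul (by positivity)]
    exact ENNReal.ofReal_le_one.mpr hM
  refine (lintegral_trieHeight_le (fun t : T => P t) (ENNReal.ofReal ρ) (fun t w => h t w) M
    hM').trans ?_
  rw [← ENNReal.ofReal_one, ← ENNReal.ofReal_sub _ hρ.le, ← ENNReal.ofReal_inv_of_pos h1ρ,
    ← ENNReal.ofReal_mul (by positivity), ← ENNReal.ofReal_natCast M,
    ← ENNReal.ofReal_add (by positivity) (by positivity)]
  refine ENNReal.ofReal_le_ofReal ?_
  have hMle : (M : ℝ) ≤ 2 * Real.log n / -Real.log ρ + 1 :=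
    (Nat.ceil_lt_add_one (by have := hlog2.trans_le hlog; positivity)).le
  have h3 : 1 + (1 - ρ)⁻¹ * ρ ≤ (1 + (1 - ρ)⁻¹ * ρ) / Real.log 2 * Real.log n := by
    rw [div_mul_eq_mul_div, le_div_iff₀ hlog2]
    gcongr
  calc _ ≤ 2 * Real.log n / -Real.log ρ + (1 + (1 - ρ)⁻¹ * ρ) := by linarith
    _ ≤ 2 * Real.log n / -Real.log ρ + (1 + (1 - ρ)⁻¹ * ρ) / Real.log 2 * Real.log n := by gcongr
    _ = _ := by ring

/-! ### Failure of condition (1): long constant outputs. -/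

namespace PFA

/-- A weight that decreases geometrically, in the mean, as the automaton proceeds. -/
noncomputable def outWeight {A R W : Type*} (c : PFAConfig A R W) : ℝ :=
  (1 / 4) ^ c.out.length * c.state.elim (fun _ => 1) (fun _ => 1 / 2)

lemma outWeight_nonneg {A R W : Type*} (c : PFAConfig A R W) : 0 ≤ outWeight c := by
  obtain ⟨r | q, i, o⟩ := c <;> simp only [outWeight, Sum.elim_inl, Sum.elim_inr] <;> positivity

variable {A R W : Type*} [Fintype A] [Fintype R] [Fintype W]

/-- If reading `a` surely causes a deletion or the output of `b`, then every output state that is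
reachable by reading `a` writes `b` and stays put or returns to the input state. -/
lemma eq_of_μW_ne_zero (X : PFA A R W) [Subsingleton R] (s : R) {a b : A}
    (h : 1 ≤ X.μR s a (.inl s) +
        ∑ q : W, X.μR s a (.inr q) * (X.μW q b (.inr q) + X.μW q b (.inl s)))
    {q : W} (hq : X.μR s a (.inr q) ≠ 0) {b' : A} {p : R ⊕ W} (hp : X.μW q b' p ≠ 0) :
    b' = b ∧ (p = .inr q ∨ p = .inl s) := by
  classical
  let _ : Unique R := ⟨⟨s⟩, fun x => Subsingleton.elim _ _⟩
  have hd : (default : R) = s := Subsingleton.elim _ _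
  have hsum : ∀ q, ∑ ap : A × (R ⊕ W), X.μW q ap.1 ap.2 = 1 := fun q => by
    rw [Fintype.sum_prod_type]; exact X.μW_sum q
  have hpair : ∀ q, X.μW q b (.inr q) + X.μW q b (.inl s) =
      ∑ ap ∈ ({(b, .inr q), (b, .inl s)} : Finset (A × (R ⊕ W))), X.μW q ap.1 ap.2 := fun q => by
    rw [Finset.sum_pair (by simp)]
  have hle : ∀ q, X.μW q b (.inr q) + X.μW q b (.inl s) ≤ 1 := fun q => by
    rw [hpair, ← hsum q]
    exact Finset.sum_le_univ_sum_of_nonneg fun ap => X.μW_nonneg q ap.1 ap.2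
  have hR := X.μR_sum s a
  rw [Fintype.sum_sum_type, Fintype.sum_unique, hd] at hR
  have hnn : ∀ q ∈ Finset.univ, 0 ≤ X.μR s a (.inr q) *
      (1 - (X.μW q b (.inr q) + X.μW q b (.inl s))) := fun q _ =>
    mul_nonneg (X.μR_nonneg _ _ _) (sub_nonneg.mpr (hle q))
  -- The weighted deficits are nonnegative with sum at most 0, so each vanishes: a reachable `q`
  -- puts full mass on its two permitted transitions, and any further one would exceed total mass 1.
  have hz : ∑ q : W, X.μR s a (.inr q) *
      (1 - (X.μW q b (.inr q) + X.μW q b (.inl s))) = 0 := by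
    refine le_antisymm ?_ (Finset.sum_nonneg hnn)
    simp_rw [mul_sub, mul_one]
    rw [Finset.sum_sub_distrib]
    linarith
  have h1 := (mul_eq_zero.mp ((Finset.sum_eq_zero_iff_of_nonneg hnn).mp hz q
    (Finset.mem_univ q))).resolve_left hq
  by_contra hne
  have hnot : (b', p) ∉ ({(b, .inr q), (b, .inl s)} : Finset (A × (R ⊕ W))) := by
    simp only [Finset.mem_insert, Finset.mem_singleton, Prod.mk.injEq]
    tauto
  have h2 := hsum q
  have h3 := Finset.sum_le_univ_sum_of_nonneg
    (s := insert (b', p) ({(b, .inr q), (b, .inl s)} : Finset (A × (R ⊕ W))))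
    (f := fun ap : A × (R ⊕ W) => X.μW q ap.1 ap.2) fun ap => X.μW_nonneg q ap.1 ap.2
  rw [Finset.sum_insert hnot, ← hpair, h2] at h3
  have h4 := (X.μW_nonneg q b' p).lt_of_ne' hp
  linarith

/-- The configurations that are reachable within `n` steps when only symbols `a` are read and only
symbols `b` are written. -/
def IsConstantConfig (X : PFA A R W) (s : R) (a b : A) (n : ℕ) (c : PFAConfig A R W) : Prop :=
  (∀ q, c.state = .inr q → X.μR s a (.inr q) ≠ 0) ∧ c.read ≤ n ∧
    c.out = List.replicate c.out.length b

open Classical in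
/-- The weight `outWeight` on the configurations `IsConstantConfig`, infinite elsewhere. -/
noncomputable def constantWeight (X : PFA A R W) (s : R) (a b : A) (n : ℕ)
    (c : PFAConfig A R W) : ℝ≥0∞ :=
  if X.IsConstantConfig s a b n c then ENNReal.ofReal (outWeight c) else ⊤

lemma sum_mul_constantWeight_le (X : PFA A R W) (s : R) (a b : A) (n : ℕ) {ι : Type*} [Fintype ι]
    (f : ι → ℝ) (g : ι → PFAConfig A R W) (hf : ∀ i, 0 ≤ f i)
    (hg : ∀ i, f i ≠ 0 → X.IsConstantConfig s a b n (g i)) {z : ℝ}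
    (hz : ∑ i, f i * outWeight (g i) ≤ z) :
    ∑ i, ENNReal.ofReal (f i) * X.constantWeight s a b n (g i) ≤ ENNReal.ofReal z := by
  refine le_trans (le_of_eq ?_) (ENNReal.ofReal_le_ofReal hz)
  rw [ENNReal.ofReal_sum_of_nonneg fun i _ => mul_nonneg (hf i) (outWeight_nonneg _)]
  refine Finset.sum_congr rfl fun i _ => ?_
  by_cases hi : f i = 0
  · simp [hi]
  · rw [ENNReal.ofReal_mul (hf i), constantWeight, if_pos (hg i hi)]

/-- With `δ` the deletion probability, the input state gives the mean factor `δ + (1 - δ) / 2 = (1 +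
δ) / 2`. At an output state, writing gains 1/4 and returning to the input state loses at most 2, so
the factor is at most 1/2. -/
lemma lintegral_step_constantWeight_le (X : PFA A R W) [Subsingleton R] (s : R) {a b : A}
    (h : 1 ≤ X.μR s a (.inl s) +
        ∑ q : W, X.μR s a (.inr q) * (X.μW q b (.inr q) + X.μW q b (.inl s)))
    {t : ℕ → A} {N : ℕ} (ht : ∀ i < N, t i = a) {n : ℕ} (hn : n < N) (c : PFAConfig A R W) :
    ∫⁻ c', X.constantWeight s a b (n + 1) c' ∂(X.step t c).toMeasure ≤
      ENNReal.ofReal ((1 + X.μR s a (.inl s)) / 2) * X.constantWeight s a b n c := by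
  have hδ := X.μR_nonneg s a (.inl s)
  by_cases hc : X.IsConstantConfig s a b n c
  swap
  -- Outside the permitted configurations the right side is infinite, because the contraction factor
  -- is positive.
  · rw [constantWeight, if_neg hc, ENNReal.mul_top]
    · exact le_top
    · rw [ne_eq, ENNReal.ofReal_eq_zero]
      linarith
  rw [constantWeight, if_pos hc, ← ENNReal.ofReal_mul (by linarith)]
  obtain ⟨r | q, i, o⟩ := c
  · obtain rfl : r = s := Subsingleton.elim _ _
    obtain ⟨-, hi, ho⟩ := hc
    simp only at hi ho
    rw [lintegral_step_inl, ht i (by omega)]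
    refine X.sum_mul_constantWeight_le _ _ _ _ _ _ (X.μR_nonneg _ _) ?_ ?_
    · rintro p hp
      exact ⟨fun q hq => by simp only at hq; exact hq ▸ hp, by simpa using hi, ho⟩
    · let _ : Unique R := ⟨⟨r⟩, fun x => Subsingleton.elim _ _⟩
      have hd : (default : R) = r := Subsingleton.elim _ _
      have hR := X.μR_sum r a
      rw [Fintype.sum_sum_type, Fintype.sum_unique, hd] at hR ⊢
      simp only [outWeight, Sum.elim_inl, Sum.elim_inr]
      rw [← Finset.sum_mul]
      refine le_of_eq ?_
      linear_combination ((1 / 4 : ℝ) ^ o.length * (1 / 2)) * hR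
  · obtain ⟨hq, hi, ho⟩ := hc
    have hq := hq q rfl
    simp only at hi ho
    rw [lintegral_step_inr]
    refine X.sum_mul_constantWeight_le _ _ _ _ _ _ (fun ap => X.μW_nonneg _ _ _) ?_ ?_
    · rintro ⟨b', p⟩ hp
      obtain ⟨rfl, hp'⟩ := X.eq_of_μW_ne_zero s h hq hp
      refine ⟨fun q' hq' => ?_, by simp only; omega, ?_⟩
      · rcases hp' with rfl | rfl
        · obtain rfl : q = q' := by simpa using hq'
          exact hq
        · simp at hq'
      · simp only [List.length_append, List.length_singleton, List.replicate_succ', ← ho]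
    · have hsum : ∑ ap : A × (R ⊕ W), X.μW q ap.1 ap.2 = 1 := by
        rw [Fintype.sum_prod_type]; exact X.μW_sum q
      calc _ ≤ ∑ ap : A × (R ⊕ W), X.μW q ap.1 ap.2 * (1 / 4) ^ (o.length + 1) := by
            refine Finset.sum_le_sum fun ap _ => ?_
            refine mul_le_mul_of_nonneg_left ?_ (X.μW_nonneg _ _ _)
            have h4 : (0 : ℝ) < (1 / 4) ^ (o.length + 1) := by positivity
            obtain ⟨b', r | q'⟩ := ap <;>
              simp only [outWeight, Sum.elim_inl, Sum.elim_inr, List.length_append,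
                List.length_singleton] <;> linarith
        _ = (1 / 4) ^ o.length * (1 / 4) := by rw [← Finset.sum_mul, hsum, one_mul, pow_succ]
        _ ≤ _ := by
            simp only [outWeight, Sum.elim_inr]
            have h4 : (0 : ℝ) < (1 / 4) ^ o.length := by positivity
            nlinarith

/-- A permitted configuration without this prefix has written fewer than `m` symbols; the spare
factor 1/4 covers the factor 1/2 of an output state. -/
lemma le_constantWeight (X : PFA A R W) (s : R) (a b : A) (n m : ℕ) (c : PFAConfig A R W)
    (hc : ¬ List.replicate m b <+: c.out) :
    ENNReal.ofReal ((1 / 4) ^ m) ≤ X.constantWeight s a b n c := by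
  rw [constantWeight]
  split_ifs with hgood
  swap
  · exact le_top
  refine ENNReal.ofReal_le_ofReal ?_
  have hlt : c.out.length < m := by
    by_contra hge
    refine hc ?_
    rw [hgood.2.2]
    exact ⟨List.replicate (c.out.length - m) b, by
      rw [← List.replicate_add, Nat.add_sub_cancel' (not_lt.mp hge)]⟩
  have h1 : ((1 : ℝ) / 4) ^ m ≤ (1 / 4) ^ (c.out.length + 1) :=
    pow_le_pow_of_le_one (by norm_num) (by norm_num) hlt
  have h4 : (0 : ℝ) < (1 / 4) ^ c.out.length := by positivity
  rw [pow_succ] at h1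
  obtain ⟨r | q, i, o⟩ := c <;> simp only [outWeight, Sum.elim_inl, Sum.elim_inr] at * <;> linarith

lemma exists_half_le_perturb_replicate (X : PFA A R W) [Subsingleton R] {s : R}
    (hcan : X.IsCanonical s) {a b : A} (hdel : X.μR s a (.inl s) < 1)
    (h : 1 ≤ X.μR s a (.inl s) +
        ∑ q : W, X.μR s a (.inr q) * (X.μW q b (.inr q) + X.μW q b (.inl s))) (m : ℕ) :
    ∃ N : ℕ, ∀ t : ℕ → A, (∀ i < N, t i = a) →
      2⁻¹ ≤ (X.perturb t).toMeasure (cylinderSet (List.replicate m b)) := by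
  have hδ := X.μR_nonneg s a (.inl s)
  -- Markov's inequality at level `(1 / 4) ^ m` then leaves failure probability at most 1/2.
  obtain ⟨N, hN⟩ := exists_pow_lt_of_lt_one (show (0 : ℝ) < (1 / 4) ^ m * (1 / 2) by positivity)
    (show (1 + X.μR s a (.inl s)) / 2 < 1 by linarith)
  refine ⟨N, fun t ht => ?_⟩
  set β := (1 + X.μR s a (.inl s)) / 2
  rw [perturb_cylinderSet_eq_iSup]
  refine le_trans ?_ (le_iSup _ N)
  have hm : MeasurableSet {ω : ℕ → PFAConfig A R W | List.replicate m b <+: (ω N).out} :=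
    measurable_pi_apply (X := fun _ : ℕ => PFAConfig A R W) N
      (show MeasurableSet {c : PFAConfig A R W | List.replicate m b <+: c.out} from trivial)
  have hE := X.lintegral_trajectoryLaw_le t (ENNReal.ofReal β) N (X.constantWeight s a b)
    fun n hn c => X.lintegral_step_constantWeight_le s h ht hn c
  have h0 : X.constantWeight s a b 0 ⟨.inl s, 0, []⟩ = 1 := by
    rw [constantWeight, if_pos ⟨by simp, le_rfl, rfl⟩]
    simp [outWeight]
  rw [hcan.lintegral_initial, h0, mul_one] at hE
  have hmarkov : ENNReal.ofReal ((1 / 4) ^ m) * (X.trajectoryLaw t).toMeasure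
      {ω : ℕ → PFAConfig A R W | List.replicate m b <+: (ω N).out}ᶜ ≤ ENNReal.ofReal β ^ N := by
    refine le_trans ?_ hE
    have hmeas : Measurable fun ω : ℕ → PFAConfig A R W => X.constantWeight s a b N (ω N) :=
      (measurable_from_top (f := X.constantWeight s a b N)).comp (measurable_pi_apply N)
    refine le_trans ?_ (mul_meas_ge_le_lintegral hmeas (ENNReal.ofReal ((1 / 4) ^ m)))
    gcongr
    intro ω hω
    exact X.le_constantWeight s a b N m _ hω
  have hcompl : (X.trajectoryLaw t).toMeasure
      {ω : ℕ → PFAConfig A R W | List.replicate m b <+: (ω N).out}ᶜ ≤ 2⁻¹ := by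
    have hpos : ENNReal.ofReal ((1 / 4) ^ m) ≠ 0 := by simp
    rw [← ENNReal.mul_le_mul_iff_right hpos ENNReal.ofReal_ne_top]
    refine hmarkov.trans ?_
    rw [← ENNReal.ofReal_pow (by positivity), show (2⁻¹ : ℝ≥0∞) = ENNReal.ofReal (1 / 2) by
      rw [one_div, ENNReal.ofReal_inv_of_pos two_pos, ENNReal.ofReal_ofNat],
      ← ENNReal.ofReal_mul (by positivity)]
    exact ENNReal.ofReal_le_ofReal hN.le
  rw [prob_compl_eq_one_sub hm, tsub_le_iff_right] at hcompl
  rw [← ENNReal.inv_two_add_inv_two] at hcompl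
  exact (ENNReal.add_le_add_iff_left (by simp)).mp hcompl

end PFA

/-! ### Unbounded height and the equivalence. -/

lemma le_trieHeight_of_mem_cylinderSet {A ι : Type*} {u : ι → Stream'.Seq A} {i j : ι}
    (hij : i ≠ j) {w : List A} (hi : u i ∈ cylinderSet w) (hj : u j ∈ cylinderSet w) :
    (w.length : ℕ∞) ≤ trieHeight u := by
  refine le_iSup_of_le i (le_iSup_of_le j (le_iSup_of_le hij (le_iSup₂_of_le w.length ?_ le_rfl)))
  intro k hk
  exact ⟨w[k], by rw [hi k hk, List.getElem?_eq_getElem hk],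
    by rw [hj k hk, List.getElem?_eq_getElem hk]⟩

lemma smoothedTrieHeight_eq_top {A : Type*} [Nontrivial A]
    (P : (ℕ → A) → ProbabilityMeasure (Stream'.Seq A)) (a b : A) {p : ℝ≥0∞} (hp : p ≠ 0)
    (h : ∀ m : ℕ, ∃ N : ℕ, ∀ t : ℕ → A, (∀ i < N, t i = a) →
      p ≤ (P t).toMeasure (cylinderSet (List.replicate m b))) {n : ℕ} (hn : 2 ≤ n) :
    smoothedTrieHeight Set.univ n P = ⊤ := by
  classical
  have key : ∀ m : ℕ, (m : ℝ≥0∞) * p ^ n ≤ smoothedTrieHeight Set.univ n P := by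
    intro m
    obtain ⟨N, hN⟩ := h m
    obtain ⟨c, hc⟩ := exists_ne a
    -- Blocks of `a` of different lengths, all at least `N`, followed by `c` forever: distinct
    -- inputs with the required common prefix.
    let g : ℕ → ℕ → A := fun k i => if i < N + k then a else c
    have hg : Function.Injective g := by
      intro k k' hkk
      by_contra hne
      wlog hlt : k < k' generalizing k k'
      · exact this hkk.symm (Ne.symm hne) (by omega)
      have := congrFun hkk (N + k)
      simp only [g, lt_irrefl, if_false, if_pos (show N + k < N + k' by omega)] at this
      exact hc this
    let T : Finset (ℕ → A) := (Finset.range n).image g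
    have hT : T.card = n := by rw [Finset.card_image_of_injective _ hg, Finset.card_range]
    refine le_trans ?_ (le_iSup_of_le T (le_iSup_of_le (Set.subset_univ _) (le_iSup_of_le hT le_rfl)))
    obtain ⟨x, y, hxy⟩ := Fintype.exists_pair_of_one_lt_card
      (show 1 < Fintype.card T by rw [Fintype.card_coe, hT]; omega)
    let E : Set (T → Stream'.Seq A) :=
      Set.univ.pi fun _ => cylinderSet (List.replicate m b)
    have hE : MeasurableSet E :=
      MeasurableSet.pi Set.countable_univ fun _ _ => measurableSet_cylinderSet _
    -- The factor `p ^ n` does not depend on `m`, so letting `m` grow makes the bound infinite.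
    have hpE : p ^ n ≤ (ProbabilityMeasure.pi fun t : T => P t).toMeasure E := by
      rw [ProbabilityMeasure.toMeasure_pi, Measure.pi_pi]
      calc p ^ n = ∏ _t : T, p := by simp [hT]
        _ ≤ _ := by
          refine Finset.prod_le_prod' fun t _ => hN _ fun i hi => ?_
          obtain ⟨k, -, hk⟩ := Finset.mem_image.mp t.2
          rw [← hk]
          exact if_pos (by omega)
    calc (m : ℝ≥0∞) * p ^ n ≤ m * (ProbabilityMeasure.pi fun t : T => P t).toMeasure E := by gcongr
      _ = ∫⁻ u, E.indicator (fun _ => (m : ℝ≥0∞)) u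
            ∂(ProbabilityMeasure.pi fun t : T => P t).toMeasure :=
          (lintegral_indicator_const hE _).symm
      _ ≤ _ := by
          refine lintegral_mono fun u => ?_
          by_cases hu : u ∈ E
          · rw [Set.indicator_of_mem hu]
            have := le_trieHeight_of_mem_cylinderSet hxy (hu x trivial) (hu y trivial)
            rw [List.length_replicate] at this
            simpa using ENat.toENNReal_le.mpr this
          · rw [Set.indicator_of_notMem hu]
            exact zero_le
  refine ENNReal.eq_top_of_forall_nnreal_le fun r => ?_
  have hpn : p ^ n ≠ 0 := pow_ne_zero _ hp
  obtain ⟨m, hm⟩ := ENNReal.exists_nat_mul_gt hpn (ENNReal.coe_ne_top (r := r))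
  exact hm.le.trans (key m)

theorem theorem1 {A R W : Type*} [Fintype A] [Nontrivial A] [Fintype R] [Fintype W]
    (X : PFA A R W) (s : R) (hstar : X.IsStarLike) (hcan : X.IsCanonical s)
    (hdel : ∀ a : A, X.μR s a (.inl s) < 1) :
    ((∀ a b : A, X.μR s a (.inl s) +
        ∑ q : W, X.μR s a (.inr q) * (X.μW q b (.inr q) + X.μW q b (.inl s)) < 1) ↔
      ∃ C : ℝ, ∀ᶠ n : ℕ in Filter.atTop,
        smoothedTrieHeight Set.univ n X.perturb ≤ ENNReal.ofReal (C * Real.log n)) ∧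
    (¬ (∀ a b : A, X.μR s a (.inl s) +
        ∑ q : W, X.μR s a (.inr q) * (X.μW q b (.inr q) + X.μW q b (.inl s)) < 1) →
      ∀ n : ℕ, 2 ≤ n → smoothedTrieHeight Set.univ n X.perturb = ⊤) := by
  have hR : Subsingleton R := Fintype.card_le_one_iff_subsingleton.mp hstar.card_input.le
  have htop : ¬ (∀ a b : A, X.μR s a (.inl s) +
        ∑ q : W, X.μR s a (.inr q) * (X.μW q b (.inr q) + X.μW q b (.inl s)) < 1) →
      ∀ n : ℕ, 2 ≤ n → smoothedTrieHeight Set.univ n X.perturb = ⊤ := by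
    intro h n hn
    push Not at h
    obtain ⟨a, b, hab⟩ := h
    exact smoothedTrieHeight_eq_top X.perturb a b (by simp)
      (X.exists_half_le_perturb_replicate hcan (hdel a) hab) hn
  refine ⟨⟨fun h => ?_, fun ⟨C, hC⟩ => ?_⟩, htop⟩
  · obtain ⟨ρ, hρ, hρ1, hb⟩ := X.exists_perturb_cylinderSet_le s hstar hcan h
    exact exists_smoothedTrieHeight_le_log X.perturb hρ hρ1 hb
  · by_contra h
    obtain ⟨n, hn, hle⟩ := ((Filter.eventually_ge_atTop 2).and hC).exists
    rw [htop h n hn] at hle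
    exact ENNReal.ofReal_ne_top (top_le_iff.mp hle)
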